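/- A \emph{left quasigroup} is a set $Q$ with binary operations $*,\backslash$ such that $x*(x\backslash y)=y=x\backslash(x*y)$; write $L_a\colon b\mapsto a*b$. A \emph{rack} is a left quasigroup satisfying $x*(y*z)=(x*y)*(x*z)$. A left quasigroup is \emph{medial} if $(x*y)*(z*w)=(x*z)*(y*w)$ for all $x,y,z,w$; \emph{connected} if the group generated by $\{L_a : a\in Q\}$ acts transitively on $Q$; \emph{superconnected} if all its subalgebras (subsets closed under $*$ and $\backslash$) are connected. For an abelian group $A$, $f\in\mathrm{End}(A)$, $g\in\mathrm{Aut}(A)$ and $c\in A$, let $\mathrm{Aff}(A,f,g,c)$ be the set $A$ with $a*b=f(a)+g(b)+c$; a left quasigroup is \emph{affine} if it is isomorphic to one of this form. For a cyclic group $C$ with generator $1$, $(C,+1)$ is the set $C$ with $a*b=b+1$. A left quasigroup $Q$ is \emph{abelian} (in the sense of commutator theory) if for every $n\ge 0$, every $(n+1)$-ary term operation $t$ in $*,\backslash$, all $a,b\in Q$ and all $u,v\in Q^n$, $t(a,u)=t(a,v)$ implies $t(b,u)=t(b,v)$. \textbf{Theorem.} Let $Q$ be a nonempty superconnected rack. (1)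 If $Q$ is medial, then $Q\cong \mathrm{Aff}(A,1-f,f,0)\times(C,+1)$ for some abelian group $A$, some $f\in\mathrm{Aut}(A)$ with $1-f\in\mathrm{Aut}(A)$, and some cyclic group $C$ (finite or infinite). (2) The following are equivalent: (i) $Q$ is medial; (ii) $Q$ is affine; (iii) $Q$ is abelian. -/

import Mathlib

universe u v

/-- A left quasigroup: a set with operations `x * y` (written `op x y`) and left division
`x \ y` (written `ldiv x y`) such that `x * (x \ y) = y = x \ (x * y)`. -/
class LeftQuasigroup (Q : Type u) where
  op : Q → Q → Q
  ldiv : Q → Q → Q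
  op_ldiv : ∀ x y, op x (ldiv x y) = y
  ldiv_op : ∀ x y, ldiv x (op x y) = y

namespace LeftQuasigroup

/-- Every rack is a left quasigroup with the same operation. -/
instance ofRack (Q : Type u) [Rack Q] : LeftQuasigroup Q where
  op := Shelf.act
  ldiv := Rack.invAct
  op_ldiv x y := Rack.right_inv x y
  ldiv_op x y := Rack.left_inv x y

/-- The left multiplication `L_a : b ↦ a * b`. -/
def L {Q : Type u} [LeftQuasigroup Q] (a : Q) : Equiv.Perm Q where
  toFun := op a
  invFun := ldiv a
  left_inv := ldiv_op a
  right_inv := op_ldiv a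

/-- The left multiplication group. -/
def LMlt (Q : Type u) [LeftQuasigroup Q] : Subgroup (Equiv.Perm Q) :=
  Subgroup.closure (Set.range L)

/-- `Q` is connected if `LMlt Q` is transitive on `Q`. -/
def IsConnected (Q : Type u) [LeftQuasigroup Q] : Prop :=
  ∀ a b : Q, ∃ h ∈ LMlt Q, h a = b

/-- Subalgebras: subsets closed under both operations. -/
structure SubLQ (Q : Type u) [LeftQuasigroup Q] where
  carrier : Set Q
  op_mem : ∀ {x y}, x ∈ carrier → y ∈ carrier → op x y ∈ carrier
  ldiv_mem : ∀ {x y}, x ∈ carrier → y ∈ carrier → ldiv x y ∈ carrier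

/-- A subalgebra is a left quasigroup in its own right. -/
instance SubLQ.instLeftQuasigroup {Q : Type u} [LeftQuasigroup Q] (S : SubLQ Q) :
    LeftQuasigroup S.carrier where
  op x y := ⟨op x.1 y.1, S.op_mem x.2 y.2⟩
  ldiv x y := ⟨ldiv x.1 y.1, S.ldiv_mem x.2 y.2⟩
  op_ldiv x y := Subtype.ext (op_ldiv x.1 y.1)
  ldiv_op x y := Subtype.ext (ldiv_op x.1 y.1)

/-- `Q` is superconnected if all its subalgebras are connected. -/
def IsSuperconnected (Q : Type u) [LeftQuasigroup Q] : Prop :=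
  ∀ S : SubLQ Q, IsConnected S.carrier

/-- The medial law `(x * y) * (z * w) = (x * z) * (y * w)`. -/
def IsMedial (Q : Type u) [LeftQuasigroup Q] : Prop :=
  ∀ x y z w : Q, op (op x y) (op z w) = op (op x z) (op y w)

/-- Two left quasigroups are isomorphic if there is a bijection between them that preserves the
multiplication (it then preserves the left division). -/
def Isomorphic (Q : Type u) (R : Type v) [LeftQuasigroup Q] [LeftQuasigroup R] : Prop :=
  ∃ e : Q ≃ R, ∀ x y : Q, e (op x y) = op (e x) (e y)

/-- The direct product. -/
instance instProd (Q : Type u) (R : Type v) [LeftQuasigroup Q] [LeftQuasigroup R] :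
    LeftQuasigroup (Q × R) where
  op x y := (op x.1 y.1, op x.2 y.2)
  ldiv x y := (ldiv x.1 y.1, ldiv x.2 y.2)
  op_ldiv x y := Prod.ext (op_ldiv x.1 y.1) (op_ldiv x.2 y.2)
  ldiv_op x y := Prod.ext (ldiv_op x.1 y.1) (ldiv_op x.2 y.2)

/-- The affine left quasigroup `Aff(A, f, g, c)`: the set `A` with `a * b = f a + g b + c`,
where `f` is an endomorphism and `g` an automorphism of the abelian group `A`. -/
def Aff {A : Type u} [AddCommGroup A] (_f : A →+ A) (_g : A ≃+ A) (_c : A) : Type u := A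

instance Aff.instLeftQuasigroup {A : Type u} [AddCommGroup A] (f : A →+ A) (g : A ≃+ A) (c : A) :
    LeftQuasigroup (Aff f g c) where
  op := fun (a b : A) => (f a + g b + c : A)
  ldiv := fun (a b : A) => (g.symm (b - f a - c) : A)
  op_ldiv := fun (a b : A) => show f a + g (g.symm (b - f a - c)) + c = b by
    rw [g.apply_symm_apply]; abel
  ldiv_op := fun (a b : A) => show g.symm (f a + g b + c - f a - c) = b by
    rw [g.symm_apply_eq]; abel

/-- The permutation left quasigroup `(S, θ)`: the set `S` with `a * b = θ b`. -/
def PermLQ {S : Type u} (_θ : Equiv.Perm S) : Type u := S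

instance PermLQ.instLeftQuasigroup {S : Type u} (θ : Equiv.Perm S) :
    LeftQuasigroup (PermLQ θ) where
  op := fun (_ b : S) => (θ b : S)
  ldiv := fun (_ b : S) => (θ.symm b : S)
  op_ldiv := fun (_ b : S) => θ.apply_symm_apply b
  ldiv_op := fun (_ b : S) => θ.symm_apply_apply b

/-- `Q` is affine if it is (up to isomorphism) of the form `Aff(A, f, g, c)`. -/
def IsAffine (Q : Type u) [LeftQuasigroup Q] : Prop :=
  ∃ (A : Type u) (_ : AddCommGroup A) (f : A →+ A) (g : A ≃+ A) (c : A),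
    Isomorphic Q (Aff f g c)

/-- Terms in the language of left quasigroups, with variables from `X`. -/
inductive Term (X : Type v) : Type v
  | var : X → Term X
  | op : Term X → Term X → Term X
  | ldiv : Term X → Term X → Term X

/-- The term operation given by a term. -/
def Term.eval {Q : Type u} [LeftQuasigroup Q] {X : Type v} (ρ : X → Q) : Term X → Q
  | .var x => ρ x
  | .op s t => LeftQuasigroup.op (s.eval ρ) (t.eval ρ)
  | .ldiv s t => LeftQuasigroup.ldiv (s.eval ρ) (t.eval ρ)

/-- `C(α, β; δ)`: the equivalence `α` centralizes `β` over `δ`, by the term condition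
for all `(n+1)`-ary term operations. -/
def Centralizes {Q : Type u} [LeftQuasigroup Q] (α β δ : Setoid Q) : Prop :=
  ∀ (n : ℕ) (t : Term (Fin (n + 1))) (a b : Q) (p q : Fin n → Q),
    α a b → (∀ i, β (p i) (q i)) →
    δ (t.eval (Fin.cons a p)) (t.eval (Fin.cons a q)) →
    δ (t.eval (Fin.cons b p)) (t.eval (Fin.cons b q))

/-- `Q` is abelian in the sense of commutator theory: the total congruence centralizes itself
over the identity congruence. -/
def IsAbelian (Q : Type u) [LeftQuasigroup Q] : Prop :=
  Centralizes (⊤ : Setoid Q) ⊤ ⊥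

end LeftQuasigroup

namespace LeftQuasigroup

/-! Superconnectedness enters twice. For `Q` itself it makes the group `dispSq Q`, generated by all
`L a * (L b)⁻¹` and the squaring map, transitive. For the subalgebra of elements whose translation
is `L a` or `L b`, with `L a` and `L b` commuting, it forces `b` to be a power of squaring applied
to `a` (`exists_sq_zpow`).

Mediality makes `dispSq Q` commutative, hence regular, so `Q` can be identified with this abelian
group `G`. With φ conjugation by `L o` and `c` the squaring map, the operation becomes (1 - φ)x + φy
+ c, where φc = c and G = (1 - φ)G + ℤc.

If φ fixes (1 - φ)g, then the translations by 0 and g commute, so g ∈ ℤc and (1 - φ)g = 0. Thus (1 -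
φ)G contains no nonzero fixed point of φ. Hence G = (1 - φ)G ⊕ ℤc, with 1 - φ bijective on the first
summand and zero on the second: this is the product in (1).

For (2), the affine model gives medial → affine. The implications affine → abelian → medial do not
involve superconnectedness. -/

lemma perm_apply_inv_self {S : Type u} (e : Equiv.Perm S) (x : S) : e (e⁻¹ x) = x :=
  e.apply_symm_apply x

lemma perm_inv_apply_self {S : Type u} (e : Equiv.Perm S) (x : S) : e⁻¹ (e x) = x :=
  e.symm_apply_apply x

/-! ### Left translations and the squaring map of a rack -/

section Rack

variable {Q : Type u} [Rack Q]

lemma L_apply (a b : Q) : L a b = op a b := rfl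

lemma L_op (a b : Q) : L (op a b) = L a * L b * (L a)⁻¹ := Rack.ad_conj a b

lemma map_L_of_forall_op {h : Equiv.Perm Q} (hh : ∀ x y, h (op x y) = op (h x) (h y)) (a : Q) :
    L (h a) = h * L a * h⁻¹ := by
  ext x
  simp only [Equiv.Perm.mul_apply, L_apply, hh, perm_apply_inv_self]

lemma L_ldiv (a b : Q) : L (ldiv a b) = (L a)⁻¹ * L b * L a := by
  have h := L_op a (ldiv a b)
  rw [op_ldiv] at h
  rw [h]; group

/-- The squaring map `x ↦ x * x` of a rack, a permutation. -/
def sq (Q : Type u) [Rack Q] : Equiv.Perm Q where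
  toFun x := op x x
  invFun x := ldiv x x
  left_inv x := by
    change (L (op x x))⁻¹ (op x x) = x
    rw [L_op, mul_inv_cancel_right]
    exact ldiv_op x x
  right_inv x := by
    change L (ldiv x x) (ldiv x x) = x
    rw [L_ldiv, inv_mul_cancel, one_mul]
    exact op_ldiv x x

lemma sq_apply (x : Q) : sq Q x = op x x := rfl

lemma L_sq (x : Q) : L (sq Q x) = L x := by
  rw [sq_apply, L_op, mul_inv_cancel_right]

lemma L_map_op (a x y : Q) : L a (op x y) = op (L a x) (L a y) := Shelf.self_distrib

lemma sq_map_op (x y : Q) : sq Q (op x y) = op (sq Q x) (sq Q y) := by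
  have h : op (sq Q x) (sq Q y) = op x (sq Q y) := by
    rw [← L_apply, L_sq, L_apply]
  rw [h]
  exact (L_map_op x y y).symm

lemma L_mul_sq (a : Q) : L a * sq Q = sq Q * L a := by
  ext x
  exact L_map_op a x x

/-- In a superconnected rack, elements with commuting left multiplications differ by a power of
the squaring map. -/
lemma IsSuperconnected.exists_sq_zpow (hQ : IsSuperconnected Q) {a b : Q}
    (hab : L a * L b = L b * L a) : ∃ k : ℤ, b = (sq Q ^ k) a := by
  have hcomm : ∀ x y : Q, (L x = L a ∨ L x = L b) → (L y = L a ∨ L y = L b) →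
      L x * L y = L y * L x := by
    rintro x y (hx | hx) (hy | hy) <;> rw [hx, hy]
    · exact hab
    · exact hab.symm
  have hop : ∀ x y : Q, (L x = L a ∨ L x = L b) → (L y = L a ∨ L y = L b) →
      L (op x y) = L y := by
    intro x y hx hy
    rw [L_op, hcomm x y hx hy, mul_inv_cancel_right]
  have hldiv : ∀ x y : Q, (L x = L a ∨ L x = L b) → (L y = L a ∨ L y = L b) →
      L (ldiv x y) = L y := by
    intro x y hx hy
    rw [L_ldiv, mul_assoc, ← hcomm x y hx hy, inv_mul_cancel_left]
  -- On this set the translations commute pairwise, so `L (op x y) = L y`: the set is closed, and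
  -- its left multiplication group preserves the value of `L`. Connectedness then gives `L b = L a`.
  let S : SubLQ Q :=
    { carrier := {z | L z = L a ∨ L z = L b}
      op_mem := fun {x y} hx hy => by
        change L _ = _ ∨ L _ = _
        rw [hop x y hx hy]; exact hy
      ldiv_mem := fun {x y} hx hy => by
        change L _ = _ ∨ L _ = _
        rw [hldiv x y hx hy]; exact hy }
  obtain ⟨h, hh, hhab⟩ := hQ S ⟨a, Or.inl rfl⟩ ⟨b, Or.inr rfl⟩
  have key : ∀ z : S.carrier, L (h z).1 = L z.1 := by
    clear hhab
    induction hh using Subgroup.closure_induction with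
    | mem x hx =>
      obtain ⟨s, rfl⟩ := hx
      intro z
      exact hop s.1 z.1 s.2 z.2
    | one => intro z; rfl
    | mul x y _ _ hx hy => intro z; rw [Equiv.Perm.mul_apply, hx, hy]
    | inv x _ hx => intro z; rw [← hx (x⁻¹ z), perm_apply_inv_self]
  have hLab : L b = L a := by
    have := key ⟨a, Or.inl rfl⟩
    rwa [hhab] at this
  have hS : ∀ s : S.carrier, L s.1 = L a := fun s => s.2.elim id fun h => h.trans hLab
  -- All elements of `S` now have the same translation, so `s * z = z * z` and every generator acts
  -- as squaring.
  have key' : ∀ z : S.carrier, ∃ k : ℤ, (h z).1 = (sq Q ^ k) z.1 := by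
    clear key hhab
    induction hh using Subgroup.closure_induction with
    | mem x hx =>
      obtain ⟨s, rfl⟩ := hx
      intro z
      refine ⟨1, ?_⟩
      change L s.1 z.1 = _
      rw [hS s, ← hS z, zpow_one]
      rfl
    | one => intro z; exact ⟨0, rfl⟩
    | mul x y _ _ hx hy =>
      intro z
      obtain ⟨k, hk⟩ := hy z
      obtain ⟨l, hl⟩ := hx (y z)
      exact ⟨l + k, by rw [Equiv.Perm.mul_apply, hl, hk, zpow_add, Equiv.Perm.mul_apply]⟩
    | inv x _ hx =>
      intro z
      obtain ⟨k, hk⟩ := hx (x⁻¹ z)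
      refine ⟨-k, ?_⟩
      rw [perm_apply_inv_self] at hk
      rw [hk, zpow_neg, perm_inv_apply_self]
  obtain ⟨k, hk⟩ := key' ⟨a, Or.inl rfl⟩
  rw [hhab] at hk
  exact ⟨k, hk⟩

/-! ### The displacement group extended by squaring -/

/-- Generators of the displacement group together with the squaring map. -/
def dispGens (Q : Type u) [Rack Q] : Set (Equiv.Perm Q) :=
  {g | (∃ a b : Q, g = L a * (L b)⁻¹) ∨ g = sq Q}

/-- The group generated by the displacements and the squaring map. -/
def dispSq (Q : Type u) [Rack Q] : Subgroup (Equiv.Perm Q) :=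
  Subgroup.closure (dispGens Q)

lemma sq_mem_dispSq : sq Q ∈ dispSq Q := Subgroup.subset_closure (Or.inr rfl)

lemma disp_mem_dispSq (a b : Q) : L a * (L b)⁻¹ ∈ dispSq Q :=
  Subgroup.subset_closure (Or.inl ⟨a, b, rfl⟩)

lemma dispSq_map_op {g : Equiv.Perm Q} (hg : g ∈ dispSq Q) :
    ∀ x y : Q, g (op x y) = op (g x) (g y) := by
  have hinv : ∀ g : Equiv.Perm Q, (∀ x y : Q, g (op x y) = op (g x) (g y)) →
      ∀ x y : Q, g⁻¹ (op x y) = op (g⁻¹ x) (g⁻¹ y) := by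
    intro g hg x y
    apply g.injective
    simp only [hg, perm_apply_inv_self]
  induction hg using Subgroup.closure_induction with
  | mem x hx =>
    rcases hx with ⟨a, b, rfl⟩ | rfl
    · intro x y
      rw [Equiv.Perm.mul_apply, hinv _ (L_map_op b), L_map_op]; rfl
    · exact sq_map_op
  | one => intro x y; rfl
  | mul g h _ _ hg hh => intro x y; simp only [Equiv.Perm.mul_apply, hg, hh]
  | inv g _ hg => exact hinv g hg

lemma conj_mem_dispSq (a : Q) {g : Equiv.Perm Q} (hg : g ∈ dispSq Q) :
    L a * g * (L a)⁻¹ ∈ dispSq Q := by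
  induction hg using Subgroup.closure_induction with
  | mem x hx =>
    rcases hx with ⟨b, c, rfl⟩ | rfl
    · have h : L a * (L b * (L c)⁻¹) * (L a)⁻¹ = L (op a b) * (L (op a c))⁻¹ := by
        rw [L_op, L_op]; group
      rw [h]
      exact disp_mem_dispSq _ _
    · rw [L_mul_sq, mul_inv_cancel_right]
      exact sq_mem_dispSq
  | one => rw [mul_one, mul_inv_cancel]; exact one_mem _
  | mul g h _ _ hg hh =>
    have : L a * (g * h) * (L a)⁻¹ = (L a * g * (L a)⁻¹) * (L a * h * (L a)⁻¹) := by group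
    rw [this]
    exact mul_mem hg hh
  | inv g _ hg =>
    have : L a * g⁻¹ * (L a)⁻¹ = (L a * g * (L a)⁻¹)⁻¹ := by group
    rw [this]
    exact inv_mem hg

lemma conj_inv_mem_dispSq (a : Q) {g : Equiv.Perm Q} (hg : g ∈ dispSq Q) :
    (L a)⁻¹ * g * L a ∈ dispSq Q := by
  induction hg using Subgroup.closure_induction with
  | mem x hx =>
    rcases hx with ⟨b, c, rfl⟩ | rfl
    · have h : (L a)⁻¹ * (L b * (L c)⁻¹) * L a = L (ldiv a b) * (L (ldiv a c))⁻¹ := by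
        rw [L_ldiv, L_ldiv]; group
      rw [h]
      exact disp_mem_dispSq _ _
    · rw [mul_assoc, ← L_mul_sq, inv_mul_cancel_left]
      exact sq_mem_dispSq
  | one => rw [mul_one, inv_mul_cancel]; exact one_mem _
  | mul g h _ _ hg hh =>
    have : (L a)⁻¹ * (g * h) * L a = ((L a)⁻¹ * g * L a) * ((L a)⁻¹ * h * L a) := by group
    rw [this]
    exact mul_mem hg hh
  | inv g _ hg =>
    have : (L a)⁻¹ * g⁻¹ * L a = ((L a)⁻¹ * g * L a)⁻¹ := by group
    rw [this]
    exact inv_mem hg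

/-- Since `s * z = L s ((L z)⁻¹ (z * z))`, a translation moves each point as some element of `dispSq
Q` does, an element that depends on the point. -/
lemma IsSuperconnected.exists_dispSq (hQ : IsSuperconnected Q) (a b : Q) :
    ∃ g ∈ dispSq Q, g a = b := by
  let S : SubLQ Q := ⟨Set.univ, fun _ _ => trivial, fun _ _ => trivial⟩
  obtain ⟨h, hh, hhab⟩ := hQ S ⟨a, trivial⟩ ⟨b, trivial⟩
  have key : ∀ z : S.carrier, ∃ g ∈ dispSq Q, g z.1 = (h z).1 := by
    clear hhab
    induction hh using Subgroup.closure_induction with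
    | mem x hx =>
      obtain ⟨s, rfl⟩ := hx
      intro z
      refine ⟨L s.1 * (L z.1)⁻¹ * sq Q, mul_mem (disp_mem_dispSq _ _) sq_mem_dispSq, ?_⟩
      change L s.1 ((L z.1)⁻¹ (L z.1 z.1)) = L s.1 z.1
      rw [perm_inv_apply_self]
    | one => intro z; exact ⟨1, one_mem _, rfl⟩
    | mul x y _ _ hx hy =>
      intro z
      obtain ⟨k, hk, hk'⟩ := hy z
      obtain ⟨l, hl, hl'⟩ := hx (y z)
      exact ⟨l * k, mul_mem hl hk, by rw [Equiv.Perm.mul_apply, hk', hl', Equiv.Perm.mul_apply]⟩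
    | inv x _ hx =>
      intro z
      obtain ⟨k, hk, hk'⟩ := hx (x⁻¹ z)
      refine ⟨k⁻¹, inv_mem hk, ?_⟩
      rw [perm_apply_inv_self] at hk'
      rw [← hk', perm_inv_apply_self]
  obtain ⟨g, hg, hg'⟩ := key ⟨a, trivial⟩
  exact ⟨g, hg, by rw [hg', hhab]⟩

/-! ### Mediality and the affine model -/

lemma IsMedial.L_swap (hQ : IsMedial Q) (x y z : Q) :
    L y * (L x)⁻¹ * L z = L z * (L x)⁻¹ * L y := by
  have h : L (op x y) * L z = L (op x z) * L y := Equiv.ext fun w => hQ x y z w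
  rw [L_op, L_op] at h
  simpa only [mul_assoc, mul_right_inj] using h

/-- `L_swap` exchanges the outer factors of `L a * (L b)⁻¹ * L c`; its inverse exchanges those of
`(L b)⁻¹ * L a * (L d)⁻¹`. Together they commute two displacements. Squaring commutes with every
translation. -/
lemma IsMedial.dispGens_comm (hQ : IsMedial Q) :
    ∀ g ∈ dispGens Q, ∀ h ∈ dispGens Q, g * h = h * g := by
  have hsq : ∀ a b : Q, L a * (L b)⁻¹ * sq Q = sq Q * (L a * (L b)⁻¹) := by
    intro a b
    have hb : (L b)⁻¹ * sq Q = sq Q * (L b)⁻¹ := by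
      rw [inv_mul_eq_iff_eq_mul, ← mul_assoc, L_mul_sq, mul_inv_cancel_right]
    rw [mul_assoc, hb, ← mul_assoc, L_mul_sq, mul_assoc]
  rintro g (⟨a, b, rfl⟩ | rfl) h (⟨c, d, rfl⟩ | rfl)
  · have h1 := hQ.L_swap b a c
    have h2 : (L b)⁻¹ * L a * (L d)⁻¹ = (L d)⁻¹ * L a * (L b)⁻¹ := by
      have := congrArg (·⁻¹) (hQ.L_swap a d b)
      simpa only [mul_inv_rev, inv_inv, mul_assoc] using this
    calc L a * (L b)⁻¹ * (L c * (L d)⁻¹) = (L a * (L b)⁻¹ * L c) * (L d)⁻¹ := by group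
      _ = L c * ((L b)⁻¹ * L a * (L d)⁻¹) := by rw [h1]; group
      _ = L c * (L d)⁻¹ * (L a * (L b)⁻¹) := by rw [h2]; group
  · exact hsq a b
  · exact (hsq c d).symm
  · rfl

/-- A medial superconnected rack is affine over the group generated by displacements and the
squaring map. -/
lemma IsMedial.exists_affine_model [Nonempty Q] (hm : IsMedial Q) (hQ : IsSuperconnected Q) :
    ∃ (G : Type u) (_ : AddCommGroup G) (φ : G ≃+ G) (c : G) (e : Q ≃ G),
      (∀ x y, e (op x y) = (e x - φ (e x)) + φ (e y) + c) ∧ φ c = c ∧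
      ∀ g, ∃ (y : G) (k : ℤ), g = (y - φ y) + k • c := by
  obtain ⟨o⟩ := ‹Nonempty Q›
  have hcomm : ∀ g ∈ dispSq Q, ∀ h ∈ dispSq Q, g * h = h * g := by
    intro g hg h hh
    have := Subgroup.isMulCommutative_closure hm.dispGens_comm
    exact congrArg Subtype.val
      (mul_comm' (⟨g, hg⟩ : Subgroup.closure (dispGens Q)) ⟨h, hh⟩)
  let _ : CommGroup (dispSq Q) :=
    { (inferInstance : Group (dispSq Q)) with
      mul_comm := fun g h => Subtype.ext (hcomm g.1 g.2 h.1 h.2) }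
  let ψ : dispSq Q ≃* dispSq Q :=
    { toFun := fun g => ⟨L o * g.1 * (L o)⁻¹, conj_mem_dispSq o g.2⟩
      invFun := fun g => ⟨(L o)⁻¹ * g.1 * L o, conj_inv_mem_dispSq o g.2⟩
      left_inv := fun g => Subtype.ext (by simp only; group)
      right_inv := fun g => Subtype.ext (by simp only; group)
      map_mul' := fun g h => Subtype.ext (by
        change L o * (g.1 * h.1) * (L o)⁻¹ = L o * g.1 * (L o)⁻¹ * (L o * h.1 * (L o)⁻¹)
        group) }
  let s : dispSq Q := ⟨sq Q, sq_mem_dispSq⟩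
  -- A transitive commutative permutation group is regular.
  have hbij : Function.Bijective fun g : dispSq Q => g.1 o := by
    refine ⟨fun g h hgh => Subtype.ext (Equiv.ext fun x => ?_), fun x => ?_⟩
    · obtain ⟨k, hk, rfl⟩ := hQ.exists_dispSq o x
      rw [← Equiv.Perm.mul_apply, ← Equiv.Perm.mul_apply, hcomm _ g.2 _ hk, hcomm _ h.2 _ hk]
      exact congrArg k hgh
    · obtain ⟨k, hk, rfl⟩ := hQ.exists_dispSq o x
      exact ⟨⟨k, hk⟩, rfl⟩
  let E : dispSq Q ≃ Q := Equiv.ofBijective _ hbij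
  have hE : ∀ g, E g = g.1 o := fun _ => rfl
  have hLE : ∀ g : dispSq Q, L (E g) = g.1 * L o * g.1⁻¹ := fun g =>
    map_L_of_forall_op (dispSq_map_op g.2) o
  -- As `g` is an automorphism, `L (g o) = g * L o * g⁻¹`. Applied to `h o`, this is `g * ψ (g⁻¹ *
  -- h)` applied to `o * o = s o`.
  have hop : ∀ g h : dispSq Q, op (E g) (E h) = E (g / ψ g * ψ h * s) := by
    intro g h
    have h1 : (g / ψ g * ψ h * s) = g * ψ (g⁻¹ * h) * s := by
      rw [map_mul, map_inv, div_eq_mul_inv]; group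
    rw [h1, ← L_apply, hLE, hE, hE]
    change _ = g.1 ((L o * (g.1⁻¹ * h.1) * (L o)⁻¹) (L o o))
    simp only [Equiv.Perm.mul_apply, perm_inv_apply_self]
  refine ⟨Additive (dispSq Q), inferInstance, MulEquiv.toAdditive ψ, Additive.ofMul s,
    E.symm.trans Additive.ofMul, ?_, ?_, ?_⟩
  · intro x y
    obtain ⟨g, rfl⟩ := E.surjective x
    obtain ⟨h, rfl⟩ := E.surjective y
    rw [hop]
    simp only [Equiv.trans_apply, Equiv.symm_apply_apply]
    rfl
  · refine congrArg Additive.ofMul (Subtype.ext ?_)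
    change L o * sq Q * (L o)⁻¹ = sq Q
    rw [L_mul_sq, mul_inv_cancel_right]
  -- Because `L (g o) * (L o)⁻¹ = g / ψ g`, the displacements lie in the image of 1 - ψ; the
  -- remaining generator is `s`.
  · have hdisp : ∀ a b : Q, ∃ y : dispSq Q, L a * (L b)⁻¹ = (y / ψ y).1 := by
      intro a b
      obtain ⟨g, rfl⟩ := E.surjective a
      obtain ⟨h, rfl⟩ := E.surjective b
      refine ⟨g / h, ?_⟩
      have h1 : g / h / ψ (g / h) = (g / ψ g) * (h / ψ h)⁻¹ := by
        rw [map_div, div_div_div_comm, div_eq_mul_inv (g / ψ g)]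
      have h2 : ∀ g : dispSq Q, (g / ψ g).1 = L (E g) * (L o)⁻¹ := by
        intro g
        rw [hLE, div_eq_mul_inv]
        change g.1 * (L o * g.1 * (L o)⁻¹)⁻¹ = _
        group
      rw [h1]
      change _ = (g / ψ g).1 * (h / ψ h).1⁻¹
      rw [h2, h2]; group
    have key : ∀ g ∈ dispSq Q, ∃ (y : dispSq Q) (k : ℤ), g = ((y / ψ y) * s ^ k).1 := by
      intro g hg
      induction hg using Subgroup.closure_induction with
      | mem x hx =>
        rcases hx with ⟨a, b, rfl⟩ | rfl
        · obtain ⟨y, hy⟩ := hdisp a b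
          exact ⟨y, 0, by rw [hy, zpow_zero, mul_one]⟩
        · exact ⟨1, 1, by rw [map_one, div_one, one_mul, zpow_one]⟩
      | one => exact ⟨1, 0, by rw [map_one, div_one, one_mul, zpow_zero]; rfl⟩
      | mul g h _ _ hg hh =>
        obtain ⟨y, k, rfl⟩ := hg
        obtain ⟨z, l, rfl⟩ := hh
        refine ⟨y * z, k + l, ?_⟩
        rw [map_mul, mul_div_mul_comm, zpow_add, mul_mul_mul_comm]
        rfl
      | inv g _ hg =>
        obtain ⟨y, k, rfl⟩ := hg
        refine ⟨y⁻¹, -k, ?_⟩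
        have h1 : (y / ψ y * s ^ k)⁻¹ = y⁻¹ / ψ y⁻¹ * s ^ (-k) := by
          rw [mul_inv, map_inv, inv_div_inv, inv_div, zpow_neg]
        exact congrArg Subtype.val h1
    intro g
    obtain ⟨y, k, hy⟩ := key (Additive.toMul g).1 (Additive.toMul g).2
    exact ⟨Additive.ofMul y, k, congrArg Additive.ofMul (Subtype.ext hy)⟩

/-! ### Abelian, affine and medial -/

/-- The term (v₁ \ v₀) * ((v₁ \ v₂) \ v₃) collapses to v₃ when v₀ = v₂, whatever v₁ is. The term
condition lets v₀ vary while v₁ still does not matter, which yields the swap identity for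
translations, equivalent to mediality. -/
lemma IsAbelian.isMedial (hQ : IsAbelian Q) : IsMedial Q := by
  have key : ∀ x y z w : Q, op (ldiv z y) (ldiv (ldiv z x) w) =
      op (ldiv x y) (ldiv (ldiv x x) w) := by
    intro x y z w
    have h := hQ 3 (.op (.ldiv (.var 1) (.var 0)) (.ldiv (.ldiv (.var 1) (.var 2)) (.var 3)))
      x y ![z, x, w] ![x, x, w] trivial (fun _ => trivial)
    refine h ?_
    change op (ldiv z x) (ldiv (ldiv z x) w) = op (ldiv x x) (ldiv (ldiv x x) w)
    rw [op_ldiv, op_ldiv]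
  have hL : ∀ x y z : Q, L y * (L x)⁻¹ * L z = L z * (L x)⁻¹ * L y := by
    intro x y z
    have h : L (ldiv z y) * (L (ldiv z x))⁻¹ = L (ldiv x y) * (L (ldiv x x))⁻¹ :=
      Equiv.ext fun w => key x y z w
    simp only [L_ldiv] at h
    have h1 : (L z)⁻¹ * L y * L z * ((L z)⁻¹ * L x * L z)⁻¹
        = (L z)⁻¹ * (L y * (L x)⁻¹ * L z) := by group
    have h2 : (L x)⁻¹ * L y * L x * ((L x)⁻¹ * L x * L x)⁻¹ = (L x)⁻¹ * L y := by group
    rw [h1, h2, inv_mul_eq_iff_eq_mul] at h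
    rw [h, mul_assoc]
  intro x y z w
  have h : L (op x y) * L z = L (op x z) * L y := by
    rw [L_op, L_op]
    have := congrArg (L x * ·) (hL x y z)
    simpa only [mul_assoc] using this
  exact congrArg (· w) h

end Rack

/-- Term operations of a left quasigroup isomorphic to an affine one split off a variable
additively. -/
lemma exists_eval_eq_add {Q : Type u} [LeftQuasigroup Q] {A : Type v} [AddCommGroup A]
    (f : A →+ A) (g : A ≃+ A) (c : A) (e : Q ≃ A)
    (he : ∀ x y, e (op x y) = f (e x) + g (e y) + c) {n : ℕ} (t : Term (Fin (n + 1))) :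
    ∃ (α : A → A) (β : (Fin n → Q) → A),
      ∀ a p, e (t.eval (Fin.cons a p : Fin (n + 1) → Q)) = α (e a) + β p := by
  have hl : ∀ x y, e (ldiv x y) = g.symm (e y - f (e x) - c) := by
    intro x y
    rw [eq_comm, AddEquiv.symm_apply_eq]
    have := he x (ldiv x y)
    rw [op_ldiv] at this
    rw [this]; abel
  induction t with
  | var i =>
    refine Fin.cases ⟨id, fun _ => 0, fun a p => ?_⟩
      (fun i => ⟨fun _ => 0, fun p => e (p i), fun a p => ?_⟩) i
    · simp [Term.eval]
    · simp [Term.eval]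
  | op s t hs ht =>
    obtain ⟨α, β, h⟩ := hs
    obtain ⟨γ, δ, h'⟩ := ht
    refine ⟨fun a => f (α a) + g (γ a), fun p => f (β p) + g (δ p) + c, fun a p => ?_⟩
    rw [Term.eval, he, h, h', map_add, map_add, add_add_add_comm, add_assoc, add_assoc, add_assoc]
  | ldiv s t hs ht =>
    obtain ⟨α, β, h⟩ := hs
    obtain ⟨γ, δ, h'⟩ := ht
    refine ⟨fun a => g.symm (γ a - f (α a)), fun p => g.symm (δ p - f (β p) - c), fun a p => ?_⟩
    rw [Term.eval, hl, h, h', ← map_add, map_add]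
    congr 1; abel

lemma IsAffine.isAbelian {Q : Type u} [LeftQuasigroup Q] (hQ : IsAffine Q) : IsAbelian Q := by
  obtain ⟨A, _, f, g, c, e, he⟩ := hQ
  intro n t a b p q _ _ h
  obtain ⟨α, β, hαβ⟩ := exists_eval_eq_add f g c (e : Q ≃ A) he t
  have h0 := congrArg e h
  have h1 : β p = β q := add_left_cancel ((hαβ a p).symm.trans (h0.trans (hαβ a q)))
  exact e.injective ((hαβ b p).trans ((congrArg _ h1).trans (hαβ b q).symm))

/-! ### Splitting the affine model -/

/-- A superconnected rack with an affine model over `G` generated by the image of `1 - φ` and the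
constant splits as a product of a connected affine quandle and a cyclic permutation rack. -/
lemma IsSuperconnected.exists_isomorphic_prod {Q : Type u} [Rack Q] (hQ : IsSuperconnected Q)
    {G : Type u} [AddCommGroup G] (φ : G ≃+ G) (c : G) (e : Q ≃ G)
    (he : ∀ x y, e (op x y) = (e x - φ (e x)) + φ (e y) + c) (hc : φ c = c)
    (hgen : ∀ g, ∃ (y : G) (k : ℤ), g = (y - φ y) + k • c) :
    ∃ (A : Type u) (_ : AddCommGroup A) (f : A ≃+ A)
      (C : Type) (_ : AddCommGroup C) (g : C),
      Function.Bijective (AddMonoidHom.id A - f.toAddMonoidHom) ∧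
      (∀ x : C, x ∈ AddSubgroup.zmultiples g) ∧
      Isomorphic Q
        (Aff (AddMonoidHom.id A - f.toAddMonoidHom) f (0 : A) × PermLQ (Equiv.addRight g)) := by
  have hsq : ∀ x, e (sq Q x) = e x + c := fun x => by
    rw [sq_apply, he]; abel
  have hsqz : ∀ (k : ℤ) x, e ((sq Q ^ k) x) = e x + k • c := by
    intro k
    induction k with
    | zero => intro x; simp
    | succ k ih =>
      intro x
      rw [zpow_add_one, Equiv.Perm.mul_apply, ih, hsq, add_zsmul, one_zsmul]; abel
    | pred k ih =>
      intro x
      have h1 := hsq ((sq Q)⁻¹ x)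
      rw [perm_apply_inv_self] at h1
      rw [zpow_sub_one, Equiv.Perm.mul_apply, ih, h1, sub_zsmul, one_zsmul]; abel
  have hfix : ∀ k : ℤ, φ (k • c) = k • c := fun k => by rw [map_zsmul, hc]
  -- The two composites of the translations by 0 and g differ exactly by φ((1 - φ)g) against (1 -
  -- φ)g. As squaring is translation by `c`, `exists_sq_zpow` puts g in ℤc.
  have hcent : ∀ g, φ (g - φ g) = g - φ g → ∃ k : ℤ, g = k • c := by
    intro g hg
    have hcomm : L (e.symm 0) * L (e.symm g) = L (e.symm g) * L (e.symm 0) := by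
      refine Equiv.ext fun x => e.injective ?_
      simp only [Equiv.Perm.mul_apply, L_apply, he, Equiv.apply_symm_apply, map_add, map_zero, sub_self, hg, hc]
      abel
    obtain ⟨k, hk⟩ := hQ.exists_sq_zpow hcomm
    refine ⟨k, ?_⟩
    have := hsqz k (e.symm 0)
    rwa [← hk, Equiv.apply_symm_apply, Equiv.apply_symm_apply, zero_add] at this
  have hint : ∀ g, φ (g - φ g) = g - φ g → g - φ g = 0 := by
    intro g hg
    obtain ⟨k, rfl⟩ := hcent g hg
    rw [hfix, sub_self]
  let A : AddSubgroup G := (AddMonoidHom.id G - φ.toAddMonoidHom).range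
  have hA : ∀ y, y - φ y ∈ A := fun y => ⟨y, rfl⟩
  let f : A ≃+ A :=
    { toFun := fun a => ⟨φ a.1, by
        obtain ⟨_, y, rfl⟩ := a
        exact ⟨φ y, (map_sub φ y (φ y)).symm⟩⟩
      invFun := fun a => ⟨φ.symm a.1, by
        obtain ⟨_, y, rfl⟩ := a
        refine ⟨φ.symm y, ?_⟩
        change φ.symm y - φ (φ.symm y) = φ.symm (y - φ y)
        rw [map_sub, φ.symm_apply_apply, φ.apply_symm_apply]⟩
      left_inv := fun a => Subtype.ext (φ.symm_apply_apply a.1)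
      right_inv := fun a => Subtype.ext (φ.apply_symm_apply a.1)
      map_add' := fun a b => Subtype.ext (map_add φ a.1 b.1) }
  have hAfix : ∀ a ∈ A, φ a = a → a = 0 := by
    rintro _ ⟨y, rfl⟩ h
    exact hint y h
  let Z := AddSubgroup.zmultiples c
  -- A copy of ℤc in `Type`. If ℤc is infinite, `Nat.card` is 0 and `ZMod 0` is ℤ.
  let ε : ZMod (Nat.card Z) ≃+ Z :=
    zmodAddCyclicAddEquiv (inferInstance : IsAddCyclic Z)
  let γ : ZMod (Nat.card Z) := ε.symm ⟨c, AddSubgroup.mem_zmultiples c⟩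
  have hγ : (ε γ).1 = c := by rw [ε.apply_symm_apply]
  let F : A × ZMod (Nat.card Z) → G := fun p => p.1.1 + (ε p.2).1
  have hF : Function.Bijective F := by
    constructor
    · rintro ⟨a, x⟩ ⟨b, y⟩ h
      have h1 : a.1 - b.1 = (ε y).1 - (ε x).1 := by
        rw [sub_eq_sub_iff_add_eq_add, add_comm (ε y).1]; exact h
      have h2 : a.1 - b.1 = 0 := by
        -- The difference lies in both `A` and ℤc, and φ fixes ℤc pointwise.
        refine hAfix _ (sub_mem a.2 b.2) ?_
        rw [h1]
        obtain ⟨k, hk⟩ := AddSubgroup.mem_zmultiples_iff.1 (sub_mem (ε y).2 (ε x).2)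
        rw [← hk, hfix]
      rw [h2] at h1
      exact Prod.ext (Subtype.ext (sub_eq_zero.1 h2))
        (ε.injective (Subtype.ext (sub_eq_zero.1 h1.symm).symm))
    · intro g
      obtain ⟨y, k, rfl⟩ := hgen g
      refine ⟨(⟨y - φ y, hA y⟩, ε.symm ⟨k • c, AddSubgroup.mem_zmultiples_iff.2 ⟨k, rfl⟩⟩), ?_⟩
      change y - φ y + (ε (ε.symm _)).1 = _
      rw [ε.apply_symm_apply]
  let F' : A × ZMod (Nat.card Z) ≃ G := Equiv.ofBijective F hF
  refine ⟨A, inferInstance, f, ZMod (Nat.card Z), inferInstance, γ, ⟨?_, ?_⟩, ?_,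
    e.trans (F'.symm : G ≃ A × ZMod (Nat.card Z)), ?_⟩
  · rw [injective_iff_map_eq_zero]
    intro a ha
    exact Subtype.ext (hAfix a.1 a.2 (sub_eq_zero.1 (congrArg Subtype.val ha)).symm)
  -- Since 1 - φ kills ℤc, writing y = (1 - φ)z + kc gives (1 - φ)y = (1 - φ)((1 - φ)z).
  · rintro ⟨_, y, rfl⟩
    obtain ⟨z, k, rfl⟩ := hgen y
    refine ⟨⟨z - φ z, hA z⟩, Subtype.ext ?_⟩
    change (z - φ z) - φ (z - φ z) = (z - φ z + k • c) - φ (z - φ z + k • c)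
    rw [map_add, hfix]; abel
  · intro x
    obtain ⟨k, hk⟩ := AddSubgroup.mem_zmultiples_iff.1 (ε x).2
    refine AddSubgroup.mem_zmultiples_iff.2 ⟨k, ε.injective (Subtype.ext ?_)⟩
    rw [map_zsmul, ← hk, AddSubgroup.coe_zsmul, hγ]
  · intro x y
    obtain ⟨⟨a, k⟩, hx⟩ := F'.surjective (e x)
    obtain ⟨⟨b, l⟩, hy⟩ := F'.surjective (e y)
    have hk : φ (ε k).1 = (ε k).1 := by
      obtain ⟨k, hk⟩ := AddSubgroup.mem_zmultiples_iff.1 (ε k).2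
      rw [← hk, hfix]
    have hl : φ (ε l).1 = (ε l).1 := by
      obtain ⟨k, hk⟩ := AddSubgroup.mem_zmultiples_iff.1 (ε l).2
      rw [← hk, hfix]
    have hx' : F'.symm (e x) = (a, k) := by rw [← hx, F'.symm_apply_apply]
    have hy' : F'.symm (e y) = (b, l) := by rw [← hy, F'.symm_apply_apply]
    let m : A := (AddMonoidHom.id A - f.toAddMonoidHom) a + f b + 0
    have hxy : F'.symm (e (op x y)) = (m, l + γ) := by
      rw [Equiv.symm_apply_eq, he, ← hx, ← hy]
      change a.1 + (ε k).1 - φ (a.1 + (ε k).1) + φ (b.1 + (ε l).1) + c =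
        (a.1 - φ a.1 + φ b.1 + 0) + (ε (l + γ)).1
      rw [map_add ε, AddSubgroup.coe_add, hγ, map_add, map_add, hk, hl]
      abel
    refine hxy.trans ?_
    change ((m, l + γ) : A × ZMod (Nat.card Z)) =
      ((AddMonoidHom.id A - f.toAddMonoidHom) (F'.symm (e x)).1 + f (F'.symm (e y)).1 + 0,
        (F'.symm (e y)).2 + γ)
    rw [hx', hy']

end LeftQuasigroup

theorem mainTheorem7 (Q : Type u) [Rack Q] [Nonempty Q]
    (hQ : LeftQuasigroup.IsSuperconnected Q) :
    (LeftQuasigroup.IsMedial Q →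
      ∃ (A : Type u) (_ : AddCommGroup A) (f : A ≃+ A)
        (C : Type) (_ : AddCommGroup C) (g : C),
        Function.Bijective (AddMonoidHom.id A - f.toAddMonoidHom) ∧
        (∀ x : C, x ∈ AddSubgroup.zmultiples g) ∧
        LeftQuasigroup.Isomorphic Q
          (LeftQuasigroup.Aff (AddMonoidHom.id A - f.toAddMonoidHom) f (0 : A) ×
            LeftQuasigroup.PermLQ (Equiv.addRight g))) ∧
    [LeftQuasigroup.IsMedial Q, LeftQuasigroup.IsAffine Q, LeftQuasigroup.IsAbelian Q].TFAE := by
  refine ⟨fun hm => ?_, ?_⟩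
  · obtain ⟨G, _, φ, c, e, he, hc, hgen⟩ := hm.exists_affine_model hQ
    exact hQ.exists_isomorphic_prod φ c e he hc hgen
  · tfae_have 1 → 2 := fun hm => by
      obtain ⟨G, _, φ, c, e, he, -, -⟩ := hm.exists_affine_model hQ
      exact ⟨G, inferInstance, AddMonoidHom.id G - φ.toAddMonoidHom, φ, c, e, he⟩
    tfae_have 2 → 3 := fun h => h.isAbelian
    tfae_have 3 → 1 := fun h => h.isMedial
    tfae_finish
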